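/- Let $F_4=\{0,1,w,w^2\}$ with $w^2+w+1=0$. A quaternary additive $[n,\kappa,d]_4$ code is an additive subgroup $C\le F_4^n$ with $\log_4|C|=\kappa$ and minimum Hamming weight $d$; its weight distribution is $1+\sum_{i=1}^n A_i z^i$, where $A_i$ is the number of codewords of weight $i$, and it is a two-weight code if exactly two of $A_1,\dots,A_n$ are nonzero. For positive integers $K,D$ put $g(K,D)=\sum_{i=0}^{K-1}\lceil D/2^i\rceil$. An additive $[n,K/2,d]_4$ code is a *Griesmer code* if $3n=g(K,2d)$; if $0<d<n$, it is *Griesmer puncture-optimal (GPO)* if $3n+3<g(K,2d+2)$, i.e. the additive Griesmer bound excludes $[n+1,K/2,d+1]_4$ codes, so that no such additive code exists. The code generated by a matrix over $F_4$ is the additive group generated by its rows, and the generator multiset of a matrix is the multiset of its columns. For a matrix $A$ let $A^\circ=(A\mid 0)$ be $A$ with one zero column appended; let $A\star B$ be the matrix whose columns are $\binom{\alpha}{\beta}$ for all columns $\alpha$ of $A$ and $\beta$ of $B$; and let $(A^\circ\star B^\circ)^\ominus$ be $A^\circ\star B^\circ$ without the zero column coming from the two appended columns. An additive code is ASEP if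 in each of its codewords the symbols $1,w,w^2$ occur equally often; the $\frac{k}{2}$-dimensional ASEP codes considered here (for integers $k\ge 3$) are those with parameters $[2^k-1,\frac k2,3\cdot 2^{k-2}]_4$, and a matrix $A_{k/2}$ with $k$ rows generating such a code is called a generator matrix of it. One *iteration step* replaces a matrix $A$ with $k$ rows by the matrix with $k+2$ rows whose columns are $(\alpha,\beta,w\beta)^T$ for $\alpha$ a column of $A$ and $\beta\in F_4$, together with $(0,\beta,w\beta)^T$ for $\beta\in F_4\setminus\{0\}$, the columns being listed in any order. Let $k=k_1+k_2$ with $k_1\ge3$ odd and $k_2=2l\ge4$ even, and let $m\in\{1,2,3\}$. Let $A_{k_1/2}$ be a matrix with $k_1$ rows obtained from a generator matrix of an ASEP code as above by finitely many (possibly no) iteration steps. Let $G$ be a generator matrix of the $l$-dimensional quaternary Simplex code (its columns represent each point of the projective space of $F_4^l$ exactly once), and let $$A_{k_2/2}=\left(\begin{array}{c|c|c}G&wG&w^2G\\ wG&w^2G&G\end{array}\right).$$ Such matrices $A_{k_1/2}$ and $G$ exist. Let $\mathcal L_{k/2}$ be the generator multiset of $(A_{k_1/2}^\circ\star A_{k_2/2}^\circ)^\ominus$,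 and let $\mathcal L'_{m}$ be the generator multiset of the matrix consisting of $k_1$ zero rows on top of the first $m$ of the three column blocks of $A_{k_2/2}$. Then, for all such $A_{k_1/2}$ and $G$, $\mathcal L'_m\subseteq\mathcal L_{k/2}$, and the following holds for the additive code generated by any matrix with generator multiset $\mathcal L_{k/2}\setminus\mathcal L'_m$. (1) It is a two-weight code with parameters $$\Big[2^k-1-m\cdot\tfrac{2^{k_2}-1}{3},\ \tfrac k2,\ 3\cdot2^{k-2}-m\cdot2^{k_2-2}\Big]_4$$ and weight distribution $$1+(2^k-2^{k_1})\,z^{3\cdot 2^{k-2}-m\cdot 2^{k_2-2}}+(2^{k_1}-1)\,z^{3\cdot 2^{k-2}}.$$ (2) It is GPO for every $m\in\{1,2,3\}$; it is a Griesmer code if and only if $m=1$. -/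

import Mathlib

open scoped Polynomial

namespace AddCode

variable {F : Type*} [Field F] [Fintype F] [DecidableEq F]

/-! ### Quaternary additive codes

Throughout, `F` is a field with four elements and `w : F` satisfies `w ^ 2 + w + 1 = 0`.
A quaternary additive code with coordinates indexed by `ι` is an `AddSubgroup (ι → F)`. -/

/-- `C` is an additive `[n, k, d]₄` code: it has length `n`, dimension `k = log₄ |C|`
(not necessarily an integer) and minimum Hamming weight exactly `d`. -/
def HasParams {ι : Type*} [Fintype ι] (C : AddSubgroup (ι → F)) (n : ℕ) (k : ℝ) (d : ℕ) : Prop :=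
  Fintype.card ι = n ∧ Real.logb 4 (Nat.card C) = k ∧
    IsLeast {x : ℕ | ∃ c ∈ C, c ≠ 0 ∧ hammingNorm c = x} d

/-- `A_i`: the number of codewords of weight `i`. -/
noncomputable def weightCount {ι : Type*} [Fintype ι] (C : AddSubgroup (ι → F)) (i : ℕ) : ℕ :=
  Nat.card {c : ι → F // c ∈ C ∧ hammingNorm c = i}

/-- The weight distribution `1 + A_1 z + ⋯ + A_n z ^ n`. -/
noncomputable def weightDistribution {ι : Type*} [Fintype ι] (C : AddSubgroup (ι → F)) : ℤ[X] :=
  1 + ∑ i ∈ Finset.Icc 1 (Fintype.card ι), (weightCount C i : ℤ[X]) * Polynomial.X ^ i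

/-- `C` is a `t`-weight code: exactly `t` of the numbers `A_1, …, A_n` are nonzero. -/
def IsTWeight {ι : Type*} [Fintype ι] (C : AddSubgroup (ι → F)) (t : ℕ) : Prop :=
  ((Finset.Icc 1 (Fintype.card ι)).filter fun i => weightCount C i ≠ 0).card = t

/-- `g(K, D) = ∑_{i < K} ⌈D / 2 ^ i⌉`; so `g(2k, 2d) = ∑_{i=0}^{2k-1} ⌈d / 2 ^ (i - 1)⌉`. -/
def griesmer (K D : ℕ) : ℕ := ∑ i ∈ Finset.range K, ⌈(D : ℚ) / 2 ^ i⌉₊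

/-- An additive `[n, K / 2, d]₄` code is a Griesmer code if `3 n = g(K, 2 d)`. -/
def IsGriesmer {ι : Type*} [Fintype ι] (C : AddSubgroup (ι → F)) : Prop :=
  ∃ n K d : ℕ, HasParams C n ((K : ℝ) / 2) d ∧ 3 * n = griesmer K (2 * d)

/-- An additive `[n, K / 2, n - t]₄` code with `n, t > 0` is Griesmer puncture-optimal if
`3 n + 3 < g(K, 2 (n - t) + 2)`, i.e. the additive Griesmer bound excludes
`[n + 1, K / 2, n - t + 1]₄` codes; accordingly there is no such code. -/
def IsGPO {ι : Type*} [Fintype ι] (C : AddSubgroup (ι → F)) : Prop :=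
  ∃ n K d t : ℕ, 0 < n ∧ 0 < t ∧ d + t = n ∧ HasParams C n ((K : ℝ) / 2) d ∧
    3 * n + 3 < griesmer K (2 * d + 2) ∧
    ¬ ∃ C' : AddSubgroup (Fin (n + 1) → F), HasParams C' (n + 1) ((K : ℝ) / 2) (d + 1)

/-! ### Generator matrices -/

/-- The additive code generated by the rows of `A`. -/
def code {κ ι : Type*} (A : Matrix κ ι F) : AddSubgroup (ι → F) :=
  AddSubgroup.closure (Set.range A.row)

/-- The generator multiset of `A`: the multiset of its columns. -/
def gens {κ ι : Type*} [Fintype ι] (A : Matrix κ ι F) : Multiset (κ → F) :=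
  Finset.univ.val.map A.col

/-- `A°`: append one zero column (indexed by `none`). -/
def circ {κ ι : Type*} (A : Matrix κ ι F) : Matrix κ (Option ι) F :=
  Matrix.of fun i j => j.elim 0 (A i)

/-- `A ⋆ B`: every column of `A` on top of every column of `B`. -/
def starMul {κ₁ κ₂ ι₁ ι₂ : Type*} (A : Matrix κ₁ ι₁ F) (B : Matrix κ₂ ι₂ F) :
    Matrix (κ₁ ⊕ κ₂) (ι₁ × ι₂) F :=
  Matrix.of fun i p => Sum.elim (fun a => A a p.1) (fun b => B b p.2) i

/-- `(A° ⋆ B°)⊖`, where `⊖` removes the zero column coming from the two appended ones. -/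
def combine {κ₁ κ₂ ι₁ ι₂ : Type*} (A : Matrix κ₁ ι₁ F) (B : Matrix κ₂ ι₂ F) :
    Matrix (κ₁ ⊕ κ₂) {p : Option ι₁ × Option ι₂ // p ≠ (none, none)} F :=
  (starMul (circ A) (circ B)).submatrix id Subtype.val

/-! ### Additive symbol equal probability codes -/

/-- In every codeword the symbols `1`, `w`, `w ^ 2` occur equally often. -/
def IsASEP {ι : Type*} [Fintype ι] (w : F) (C : AddSubgroup (ι → F)) : Prop :=
  ∀ c ∈ C,
    (Finset.univ.filter fun i => c i = 1).card = (Finset.univ.filter fun i => c i = w).card ∧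
    (Finset.univ.filter fun i => c i = w).card = (Finset.univ.filter fun i => c i = w ^ 2).card

/-- The `k`-row matrix `A` generates an ASEP code with the standard parameters
`[2 ^ k - 1, k / 2, 3 · 2 ^ (k - 2)]₄`. -/
def IsASEPGen (w : F) (k : ℕ) {n : ℕ} (A : Matrix (Fin k) (Fin n) F) : Prop :=
  IsASEP w (code A) ∧ HasParams (code A) (2 ^ k - 1) ((k : ℝ) / 2) (3 * 2 ^ (k - 2))

/-- The matrix obtained from `A` by one step of the iteration:
its columns are `(a, β, w β)` for `a` a column of `A` and `β ∈ F`,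
and `(0, β, w β)` for `β ∈ F` nonzero. -/
def iterStep {κ ι : Type*} (w : F) (A : Matrix κ ι F) :
    Matrix (κ ⊕ Fin 2) ((ι × F) ⊕ {β : F // β ≠ 0}) F :=
  Matrix.fromBlocks (Matrix.of fun i p => A i p.1) 0
    (Matrix.of fun r p => ![p.2, w * p.2] r) (Matrix.of fun r β => ![β.1, w * β.1] r)

/-- The generator matrices `A_{k/2}` obtained from a generator matrix of an ASEP code (with
standard parameters) by finitely many (possibly zero) steps of the iteration.
The columns may be listed in any order. -/
inductive IsIterated (w : F) : (k : ℕ) → {n : ℕ} → Matrix (Fin k) (Fin n) F → Prop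
  | base {k n : ℕ} (A : Matrix (Fin k) (Fin n) F) (hk : 3 ≤ k) (hA : IsASEPGen w k A) :
      IsIterated w k A
  | step {k n n' : ℕ} (A : Matrix (Fin k) (Fin n) F) (hA : IsIterated w k A)
      (e : ((Fin n × F) ⊕ {β : F // β ≠ 0}) ≃ Fin n') :
      IsIterated w (k + 2) (Matrix.reindex finSumFinEquiv e (iterStep w A))

/-- `G` is a generator matrix of the `l`-dimensional quaternary Simplex code: its columns
represent every point of the projective space of `F ^ l` exactly once. -/
def IsSimplexGen {l s : ℕ} (G : Matrix (Fin l) (Fin s) F) : Prop :=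
  (∀ j, G.col j ≠ 0) ∧ ∀ v : Fin l → F, v ≠ 0 → ∃! j, ∃ a : F, v = a • G.col j

/-- The three-block matrix `(G, wG, w²G ; wG, w²G, G)`; the block is the first component of
the column index (recall `w ^ 3 = 1`). -/
def threeBlock {l s : ℕ} (w : F) (G : Matrix (Fin l) (Fin s) F) :
    Matrix (Fin l ⊕ Fin l) (Fin 3 × Fin s) F :=
  Matrix.of fun i p =>
    Sum.elim (fun a => w ^ (p.1 : ℕ) * G a p.2) (fun b => w ^ (p.1 + 1 : ℕ) * G b p.2) i

/-- The first `m` of the three blocks of `threeBlock w G`, below `k₁` zero rows. -/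
def anticode {l s : ℕ} (k₁ : ℕ) (w : F) (G : Matrix (Fin l) (Fin s) F) (m : ℕ) :
    Matrix (Fin k₁ ⊕ (Fin l ⊕ Fin l)) ({r : Fin 3 // (r : ℕ) < m} × Fin s) F :=
  Matrix.of fun i p =>
    Sum.elim (fun _ => 0) (fun b => threeBlock w G b (p.1.1, p.2)) i

end AddCode

/-!
The rows of a generator matrix `A` with rows indexed by `κ` are combined with binary coefficients:
the additive code of `A` consists of the words `codeword A u`, `u : κ → ZMod 2`, and the weight of
such a word is read off the generator multiset of `A` (`hammingNorm_codeword`).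

Everything rests on one property: `A` is *equidistributed* if each of its words with `u ≠ 0` takes
every value of `F` equally often. If `A` or `B` contributes an equidistributed summand, the sum is
equidistributed, so the property is inherited by `A ⋆ B` (`Equidistributed.starMul`).

* For an ASEP code with the standard parameters, the total weight of all codewords forces every
  nonzero codeword to have weight exactly `3 · 2 ^ (k - 2)`, whence `A°` is equidistributed
  (`IsASEPGen.equidistributed`).
* The columns `(v, w v)`, `v ∈ F ^ l`, form an equidistributed matrix, because `x + w y ≠ 0` for
  binary vectors `(x, y) ≠ 0`. For `l = 1` this matrix describes the iteration step
  (`Equidistributed.circ_iterStep`), and for general `l` its columns are exactly those of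
  `(threeBlock w G)°` (`circ_threeBlock`).

Hence the combined matrix has constant weight `3 · 2 ^ (k - 2)`. The anticode has weight
`m · 2 ^ (k₂ - 2)` on the words whose coefficients on the last `k₂` rows do not all vanish, and
weight `0` on the others (`hammingNorm_codeword_anticode`). Subtracting gives a two-weight code.

The additive Griesmer bound (`HasParams.griesmer_le`) is the binary one, proved by passing to
residual codes (`griesmer_le_card`), applied to the concatenation with the binary `[3, 2, 2]` code.
With `E = 3 · 2 ^ k₁ - m`, the minimum distance is `2 ^ (k₂ - 2) · E`, the length `n` satisfies
`3 n + 3 = 2 ^ k₂ · E + m`, and halving the argument step by step evaluates the Griesmer sums: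
`g(k, 2 d) - 3 n` is `0, -1, -1` and `g(k, 2 d + 2) - 3 n` is `k₂ + 1, k₂ + 1, k₂` for
`m = 1, 2, 3`.
-/

namespace AddCode

variable {F : Type*} [Field F]

/-! ### Codewords -/

section Codewords

variable [Algebra (ZMod 2) F] {κ ι : Type*} [Fintype κ]

/-- The codeword `∑ i, u i • A i` of the additive code generated by `A` that has the binary
coefficient vector `u`. -/
def codeword (A : Matrix κ ι F) : (κ → ZMod 2) →ₗ[ZMod 2] (ι → F) :=
  Fintype.linearCombination (ZMod 2) A.row

lemma codeword_apply (A : Matrix κ ι F) (u : κ → ZMod 2) (j : ι) :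
    codeword A u j = ∑ i, u i • A i j := by
  rw [codeword, Fintype.linearCombination_apply, Finset.sum_apply]
  rfl

lemma mem_code (A : Matrix κ ι F) (c : ι → F) : c ∈ code A ↔ ∃ u, codeword A u = c := by
  have h : (code A : Set (ι → F)) = LinearMap.range (codeword A) := by
    rw [codeword, Fintype.range_linearCombination]
    apply Set.Subset.antisymm
    · have : code A ≤ (Submodule.span (ZMod 2) (Set.range A.row)).toAddSubgroup :=
        (AddSubgroup.closure_le _).2 Submodule.subset_span
      exact this
    · have : Submodule.span (ZMod 2) (Set.range A.row) ≤
          AddSubgroup.toZModSubmodule 2 (code A) :=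
        Submodule.span_le.2 AddSubgroup.subset_closure
      exact this
  rw [← SetLike.mem_coe, h]
  simp

lemma hammingNorm_codeword [Fintype ι] [DecidableEq F] (A : Matrix κ ι F) (u : κ → ZMod 2) :
    hammingNorm (codeword A u) = (gens A).countP fun v => ∑ i, u i • v i ≠ 0 := by
  rw [gens, Multiset.countP_map, hammingNorm, Finset.card_def, Finset.filter_val]
  simp only [codeword_apply, Matrix.col_apply]
  rfl

lemma natCard_code_of_injective {A : Matrix κ ι F} (h : Function.Injective (codeword A)) :
    Nat.card (code A) = 2 ^ Fintype.card κ := by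
  let f : (κ → ZMod 2) → code A := fun u => ⟨codeword A u, (mem_code A _).2 ⟨u, rfl⟩⟩
  have hf : Function.Bijective f := by
    refine ⟨fun u v huv => h (congrArg Subtype.val huv), ?_⟩
    rintro ⟨c, hc⟩
    obtain ⟨u, rfl⟩ := (mem_code A c).1 hc
    exact ⟨u, rfl⟩
  rw [← Nat.card_eq_of_bijective f hf, Nat.card_fun, Nat.card_zmod, Nat.card_eq_fintype_card]

lemma weightCount_code_of_injective [Fintype ι] [DecidableEq F] [DecidableEq κ] {A : Matrix κ ι F}
    (h : Function.Injective (codeword A)) (i : ℕ) :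
    weightCount (code A) i =
      (Finset.univ.filter fun u : κ → ZMod 2 => hammingNorm (codeword A u) = i).card := by
  let f : {u : κ → ZMod 2 // hammingNorm (codeword A u) = i} →
      {c : ι → F // c ∈ code A ∧ hammingNorm c = i} :=
    fun u => ⟨codeword A u.1, (mem_code A _).2 ⟨u.1, rfl⟩, u.2⟩
  have hf : Function.Bijective f := by
    refine ⟨fun u v huv => Subtype.ext (h (congrArg Subtype.val huv)), ?_⟩
    rintro ⟨c, hc, hi⟩
    obtain ⟨u, rfl⟩ := (mem_code A c).1 hc
    exact ⟨⟨u, hi⟩, rfl⟩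
  rw [weightCount, ← Nat.card_eq_of_bijective f hf, Nat.card_eq_fintype_card,
    Fintype.card_subtype]

end Codewords

lemma logb_four_natCast_eq_iff {N K : ℕ} (hN : 0 < N) :
    Real.logb 4 (N : ℝ) = (K : ℝ) / 2 ↔ N = 2 ^ K := by
  have h4 : (4 : ℝ) ^ ((K : ℝ) / 2) = ((2 ^ K : ℕ) : ℝ) := by
    rw [show (4 : ℝ) = 2 ^ (2 : ℝ) by norm_num, ← Real.rpow_mul (by norm_num),
      mul_div_cancel₀ _ (by norm_num), Real.rpow_natCast]
    norm_num
  rw [Real.logb_eq_iff_rpow_eq (by norm_num) (by norm_num) (by exact_mod_cast hN), h4]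
  norm_cast
  exact eq_comm

section Weights

variable [DecidableEq F] [Algebra (ZMod 2) F] {κ ι : Type*} [Fintype κ] [Fintype ι]

lemma codeword_injective {A : Matrix κ ι F}
    (h : ∀ u, u ≠ 0 → 0 < hammingNorm (codeword A u)) : Function.Injective (codeword A) := by
  rw [← LinearMap.ker_eq_bot, LinearMap.ker_eq_bot']
  intro u hu
  by_contra h0
  have := h u h0
  simp [hu] at this

lemma hasParams_code [Fintype F] {A : Matrix κ ι F} {n d : ℕ} (hn : Fintype.card ι = n) (hd : 0 < d)
    (h : ∀ u, u ≠ 0 → d ≤ hammingNorm (codeword A u))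
    (h' : ∃ u, u ≠ 0 ∧ hammingNorm (codeword A u) = d) :
    HasParams (code A) n ((Fintype.card κ : ℝ) / 2) d := by
  have hinj : Function.Injective (codeword A) :=
    codeword_injective fun u hu => hd.trans_le (h u hu)
  refine ⟨hn, ?_, ?_, ?_⟩
  · rw [logb_four_natCast_eq_iff Nat.card_pos, natCard_code_of_injective hinj]
  · obtain ⟨u, hu, hud⟩ := h'
    exact ⟨codeword A u, (mem_code A _).2 ⟨u, rfl⟩, (map_ne_zero_iff _ hinj).2 hu, hud⟩
  · rintro x ⟨c, hc, hc0, rfl⟩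
    obtain ⟨u, rfl⟩ := (mem_code A c).1 hc
    exact h u (by rintro rfl; simp at hc0)

end Weights

section TwoWeights

variable [DecidableEq F] [Algebra (ZMod 2) F] {κ₁ κ₂ ι : Type*} [Fintype κ₁] [Fintype κ₂] [Fintype ι]
  [DecidableEq κ₁] [DecidableEq κ₂]

lemma card_filter_inr_eq_zero :
    (Finset.univ.filter fun u : κ₁ ⊕ κ₂ → ZMod 2 => u ∘ Sum.inr = 0).card =
      2 ^ Fintype.card κ₁ := by
  let f : {u : κ₁ ⊕ κ₂ → ZMod 2 // u ∘ Sum.inr = 0} → (κ₁ → ZMod 2) := fun u => u.1 ∘ Sum.inl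
  have hf : Function.Bijective f := by
    constructor
    · rintro ⟨u, hu⟩ ⟨v, hv⟩ huv
      ext (i | i)
      · exact congrFun huv i
      · exact (congrFun hu i).trans (congrFun hv i).symm
    · intro x
      exact ⟨⟨Sum.elim x 0, Sum.elim_comp_inr _ _⟩, Sum.elim_comp_inl _ _⟩
  rw [← Fintype.card_subtype, Fintype.card_of_bijective hf, Fintype.card_fun, ZMod.card]

variable {A : Matrix (κ₁ ⊕ κ₂) ι F} {a b : ℕ}

lemma weightCount_of_two_weights (ha : 0 < a) (hab : a < b)
    (h₁ : ∀ u, u ∘ Sum.inr ≠ 0 → hammingNorm (codeword A u) = a)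
    (h₂ : ∀ u, u ≠ 0 → u ∘ Sum.inr = 0 → hammingNorm (codeword A u) = b) {i : ℕ} (hi : 0 < i) :
    (weightCount (code A) i : ℤ) =
      if i = a then 2 ^ (Fintype.card κ₁ + Fintype.card κ₂) - 2 ^ Fintype.card κ₁
      else if i = b then 2 ^ Fintype.card κ₁ - 1 else 0 := by
  have hinj : Function.Injective (codeword A) := codeword_injective fun u hu => by
    by_cases hr : u ∘ Sum.inr = 0
    · rw [h₂ u hu hr]; exact ha.trans hab
    · rw [h₁ u hr]; exact ha
  rw [weightCount_code_of_injective hinj]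
  have hsum := Finset.card_filter_add_card_filter_not (s := Finset.univ)
    (fun u : κ₁ ⊕ κ₂ → ZMod 2 => u ∘ Sum.inr = 0)
  rw [card_filter_inr_eq_zero, Finset.card_univ, Fintype.card_fun, ZMod.card,
    Fintype.card_sum] at hsum
  split_ifs with hia hib
  · rw [eq_sub_iff_add_eq', ← Nat.cast_ofNat, ← Nat.cast_pow, ← Nat.cast_pow, ← hsum]
    push_cast
    congr 3
    ext u
    simp only [Finset.mem_filter, Finset.mem_univ, true_and]
    refine ⟨fun hu hr => ?_, fun hr => (h₁ u hr).trans hia.symm⟩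
    by_cases h0 : u = 0
    · subst h0; simp at hu; omega
    · have := h₂ u h0 hr; omega
  · have hset : (Finset.univ.filter fun u : κ₁ ⊕ κ₂ → ZMod 2 => hammingNorm (codeword A u) = i) =
        (Finset.univ.filter fun u : κ₁ ⊕ κ₂ → ZMod 2 => u ∘ Sum.inr = 0).erase 0 := by
      ext u
      simp only [Finset.mem_filter, Finset.mem_univ, true_and, Finset.mem_erase]
      constructor
      · intro hu
        have h0 : u ≠ 0 := by rintro rfl; simp at hu; omega
        refine ⟨h0, by_contra fun hr => ?_⟩
        have := h₁ u hr; omega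
      · rintro ⟨h0, hr⟩
        exact (h₂ u h0 hr).trans hib.symm
    rw [hset, Finset.card_erase_of_mem (by simp), card_filter_inr_eq_zero,
      Nat.cast_sub Nat.one_le_two_pow]
    push_cast
    rfl
  · rw [Nat.cast_eq_zero, Finset.card_eq_zero, Finset.filter_eq_empty_iff]
    intro u _ hu
    by_cases h0 : u = 0
    · subst h0; simp at hu; omega
    by_cases hr : u ∘ Sum.inr = 0
    · have := h₂ u h0 hr; omega
    · have := h₁ u hr; omega

/-- An additive code in which the weight of a nonzero codeword only depends on whether its
coefficient vector vanishes on the second block of rows. -/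
lemma two_weight_code [Fintype F] [Nonempty κ₁] [Nonempty κ₂] (ha : 0 < a) (hab : a < b)
    (h₁ : ∀ u, u ∘ Sum.inr ≠ 0 → hammingNorm (codeword A u) = a)
    (h₂ : ∀ u, u ≠ 0 → u ∘ Sum.inr = 0 → hammingNorm (codeword A u) = b) :
    IsTWeight (code A) 2 ∧
    HasParams (code A) (Fintype.card ι)
      ((Fintype.card κ₁ + Fintype.card κ₂ : ℕ) / 2) a ∧
    weightDistribution (code A) = 1 +
      (2 ^ (Fintype.card κ₁ + Fintype.card κ₂) - 2 ^ Fintype.card κ₁) * Polynomial.X ^ a +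
      (2 ^ Fintype.card κ₁ - 1) * Polynomial.X ^ b := by
  have hc₁ : (2 : ℤ) ^ (Fintype.card κ₁ + Fintype.card κ₂) - 2 ^ Fintype.card κ₁ ≠ 0 := by
    have h := Nat.pow_lt_pow_right (a := 2) (by norm_num)
      (Nat.lt_add_of_pos_right (n := Fintype.card κ₁) (Fintype.card_pos (α := κ₂)))
    have h' : (2 : ℤ) ^ Fintype.card κ₁ < 2 ^ (Fintype.card κ₁ + Fintype.card κ₂) := by
      exact_mod_cast h
    omega
  have hc₂ : (2 : ℤ) ^ Fintype.card κ₁ - 1 ≠ 0 := by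
    have h := Nat.one_lt_two_pow (Fintype.card_ne_zero (α := κ₁))
    have h' : (1 : ℤ) < 2 ^ Fintype.card κ₁ := by exact_mod_cast h
    omega
  have hwc := fun i hi => weightCount_of_two_weights (i := i) ha hab h₁ h₂ hi
  obtain ⟨i₁⟩ := ‹Nonempty κ₁›
  obtain ⟨i₂⟩ := ‹Nonempty κ₂›
  have hu₁ : hammingNorm (codeword A (Pi.single (Sum.inl i₁) 1)) = b := by
    refine h₂ _ (by simp) ?_
    ext j
    simp
  have hu₂ : hammingNorm (codeword A (Pi.single (Sum.inr i₂) 1)) = a := by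
    refine h₁ _ fun h => ?_
    simpa using congrFun h i₂
  have hbn : b ≤ Fintype.card ι := hu₁ ▸ hammingNorm_le_card_fintype
  have haI : a ∈ Finset.Icc 1 (Fintype.card ι) := by simp; omega
  have hbI : b ∈ Finset.Icc 1 (Fintype.card ι) := by simp; omega
  refine ⟨?_, ?_, ?_⟩
  · rw [IsTWeight, ← Finset.card_pair hab.ne]
    congr 1
    ext i
    rw [Finset.mem_filter, Finset.mem_insert, Finset.mem_singleton]
    constructor
    · rintro ⟨hi, hne⟩
      by_contra! hcon
      have := hwc i (Finset.mem_Icc.1 hi).1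
      rw [if_neg hcon.1, if_neg hcon.2] at this
      exact hne (by exact_mod_cast this)
    · rintro (rfl | rfl)
      · refine ⟨haI, fun h => hc₁ ?_⟩
        have := hwc i ha
        rwa [if_pos rfl, h, Nat.cast_zero, eq_comm] at this
      · refine ⟨hbI, fun h => hc₂ ?_⟩
        have := hwc i (ha.trans hab)
        rwa [if_neg hab.ne', if_pos rfl, h, Nat.cast_zero, eq_comm] at this
  · have := hasParams_code (A := A) rfl ha (fun u hu => ?_) ⟨_, ?_, hu₂⟩
    · rwa [Fintype.card_sum] at this
    · by_cases hr : u ∘ Sum.inr = 0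
      · rw [h₂ u hu hr]; exact hab.le
      · rw [h₁ u hr]
    · simp
  · rw [weightDistribution, add_assoc]
    congr 1
    rw [← Finset.sum_subset (s₁ := {a, b}), Finset.sum_pair hab.ne]
    · have e₁ := hwc a ha
      have e₂ := hwc b (ha.trans hab)
      rw [if_pos rfl] at e₁
      rw [if_neg hab.ne', if_pos rfl] at e₂
      rw [← Int.cast_natCast, ← Int.cast_natCast (weightCount _ b), e₁, e₂]
      push_cast
      rfl
    · intro i
      rw [Finset.mem_insert, Finset.mem_singleton]
      rintro (rfl | rfl) <;> assumption
    · intro i hi hne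
      rw [Finset.mem_insert, Finset.mem_singleton, not_or] at hne
      have := hwc i (Finset.mem_Icc.1 hi).1
      rw [if_neg hne.1, if_neg hne.2] at this
      rw [Nat.cast_eq_zero.1 this, Nat.cast_zero, zero_mul]

end TwoWeights

/-! ### Equidistributed matrices -/

lemma card_mul_card_fiber {V W : Type*} [AddGroup V] [Fintype V] [AddGroup W] [Fintype W]
    [DecidableEq W] (f : V →+ W) (hf : Function.Surjective f) (y : W) :
    Fintype.card W * (Finset.univ.filter fun v => f v = y).card = Fintype.card V := by
  rw [← Finset.card_univ (α := V),
    Finset.card_eq_sum_card_fiberwise (s := Finset.univ) (f := f) (t := Finset.univ) (by simp)]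
  rw [Finset.sum_congr rfl fun z _ => AddMonoidHom.card_fiber_eq_of_mem_range f (hf z) (hf y),
    Finset.sum_const, Finset.card_univ, smul_eq_mul]

lemma card_le_card_mul_card_fiber_zero {V W : Type*} [AddGroup V] [Fintype V] [AddGroup W]
    [Fintype W] [DecidableEq W] (f : V →+ W) :
    Fintype.card V ≤ Fintype.card W * (Finset.univ.filter fun v => f v = 0).card := by
  rw [← Finset.card_univ (α := V), ← Finset.card_univ (α := W), ← smul_eq_mul,
    ← Finset.sum_const,
    Finset.card_eq_sum_card_fiberwise (s := Finset.univ) (f := f) (t := Finset.univ) (by simp)]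
  refine Finset.sum_le_sum fun x _ => ?_
  by_cases hx : x ∈ Set.range f
  · exact (AddMonoidHom.card_fiber_eq_of_mem_range f hx ⟨0, map_zero f⟩).le
  · rw [Finset.filter_eq_empty_iff.2 fun v _ hv => hx ⟨v, hv⟩]
    simp

/-- `1` and `w` are linearly independent over the field with two elements. -/
lemma smul_one_add_smul_ne_zero [Algebra (ZMod 2) F] {w : F} (hw : w ^ 2 + w + 1 = 0)
    {a b : ZMod 2} (h : a ≠ 0 ∨ b ≠ 0) : a • (1 : F) + b • w ≠ 0 := by
  have key : ∀ x : ZMod 2, x = 0 ∨ x = 1 := by decide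
  have h0 : w ≠ 0 := by rintro rfl; simp at hw
  rcases key a with rfl | rfl <;> rcases key b with rfl | rfl
  · simp at h
  · simpa using h0
  · simp
  · intro h1
    rw [one_smul, one_smul, add_comm] at h1
    rw [pow_two, add_assoc, h1, add_zero] at hw
    exact h0 (mul_self_eq_zero.1 hw)

lemma circ_submatrix {κ κ' ι ι' : Type*} (A : Matrix κ ι F) (e : κ' ≃ κ) (e' : ι' ≃ ι) :
    circ (A.submatrix e e') = (circ A).submatrix e (Equiv.optionCongr e') := by
  ext i (_ | j) <;> simp [circ]

section Columns

variable [Algebra (ZMod 2) F] {κ κ' ι ι' : Type*} [Fintype κ] [Fintype κ']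

lemma codeword_starMul (A : Matrix κ ι F) (B : Matrix κ' ι' F) (u : κ ⊕ κ' → ZMod 2)
    (p : ι × ι') : codeword (starMul A B) u p =
      codeword A (u ∘ Sum.inl) p.1 + codeword B (u ∘ Sum.inr) p.2 := by
  simp [codeword_apply, starMul]

lemma codeword_circ_none (A : Matrix κ ι F) (u : κ → ZMod 2) : codeword (circ A) u none = 0 := by
  simp [codeword_apply, circ]

lemma codeword_circ_some (A : Matrix κ ι F) (u : κ → ZMod 2) (j : ι) :
    codeword (circ A) u (some j) = codeword A u j := by
  simp [codeword_apply, circ]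

lemma card_filter_option [Fintype ι] (p : Option ι → Prop) [DecidablePred p] :
    (Finset.univ.filter p).card =
      (if p none then 1 else 0) + (Finset.univ.filter fun j => p (some j)).card := by
  rw [Finset.card_filter, Fintype.sum_option, Finset.card_filter]

lemma hammingNorm_codeword_circ [Fintype ι] [DecidableEq F] (A : Matrix κ ι F) (u : κ → ZMod 2) :
    hammingNorm (codeword (circ A) u) = hammingNorm (codeword A u) := by
  rw [hammingNorm, card_filter_option]
  simp [codeword_circ_none, codeword_circ_some, hammingNorm]

end Columns

section Equidistributed

variable [Fintype F] [DecidableEq F] [Algebra (ZMod 2) F]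
  {κ κ' ι ι' : Type*} [Fintype κ] [Fintype κ'] [Fintype ι] [Fintype ι']

/-- Every codeword with a nonzero coefficient vector takes each value in `F` equally often. -/
def Equidistributed (A : Matrix κ ι F) : Prop :=
  ∀ u : κ → ZMod 2, u ≠ 0 → ∀ x : F,
    Fintype.card F * (Finset.univ.filter fun j => codeword A u j = x).card = Fintype.card ι

lemma Equidistributed.submatrix {A : Matrix κ ι F} (hA : Equidistributed A) (e : κ' ≃ κ)
    (e' : ι' ≃ ι) : Equidistributed (A.submatrix e e') := by
  intro u hu x
  have hu' : u ∘ e.symm ≠ 0 := by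
    intro h
    apply hu
    ext i
    simpa using congrFun h (e i)
  have hcw : ∀ j, codeword (A.submatrix e e') u j = codeword A (u ∘ e.symm) (e' j) := by
    intro j
    rw [codeword_apply, codeword_apply, ← e.sum_comp]
    simp
  rw [Fintype.card_congr e', ← hA _ hu' x]
  congr 1
  refine Finset.card_equiv e' fun j => ?_
  simp [hcw]

/-- It suffices that one of the two summands of a codeword is equidistributed, and one of the two
parts of a nonzero coefficient vector is nonzero. -/
lemma Equidistributed.starMul {A : Matrix κ ι F} {B : Matrix κ' ι' F} (hA : Equidistributed A)
    (hB : Equidistributed B) : Equidistributed (starMul A B) := by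
  intro u hu x
  by_cases h : u ∘ Sum.inl = 0
  · have h' : u ∘ Sum.inr ≠ 0 := by
      intro h'
      apply hu
      ext (i | i)
      · exact congrFun h i
      · exact congrFun h' i
    have : ∀ i : ι, (Finset.univ.filter fun j => codeword (AddCode.starMul A B) u (i, j) = x).card
        = (Finset.univ.filter fun j => codeword B (u ∘ Sum.inr) j = x).card := by
      intro i
      simp [codeword_starMul, h]
    rw [Finset.card_filter, Fintype.sum_prod_type]
    simp only [← Finset.card_filter, this, Finset.sum_const, Finset.card_univ, smul_eq_mul]
    rw [mul_left_comm, hB _ h', Fintype.card_prod]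
  · rw [Finset.card_filter, Fintype.sum_prod_type_right]
    simp only [← Finset.card_filter, codeword_starMul, ← eq_sub_iff_add_eq]
    rw [Finset.mul_sum, Finset.sum_congr rfl fun j _ => hA _ h _]
    simp [mul_comm]

lemma equidistributed_of_surjective {V : Type*} [AddGroup V] [Fintype V] {A : Matrix κ V F}
    (f : (κ → ZMod 2) → V →+ F) (hf : ∀ u v, codeword A u v = f u v)
    (hsurj : ∀ u, u ≠ 0 → Function.Surjective (f u)) : Equidistributed A := by
  intro u hu x
  simp only [hf]
  exact card_mul_card_fiber (f u) (hsurj u hu) x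

/-- The matrix with columns `(v, w v)`, for `v ∈ F ^ l`. -/
def doubled {l : Type*} (w : F) : Matrix (l ⊕ l) (l → F) F :=
  Matrix.of fun i v => Sum.elim v (fun b => w * v b) i

lemma equidistributed_doubled {l : Type*} [Fintype l] [DecidableEq l] {w : F}
    (hw : w ^ 2 + w + 1 = 0) : Equidistributed (doubled (l := l) w) := by
  refine equidistributed_of_surjective (fun u =>
    { toFun := fun v => ∑ i, (u (Sum.inl i) • (1 : F) + u (Sum.inr i) • w) * v i
      map_zero' := by simp
      map_add' := by intro v v'; simp [mul_add, Finset.sum_add_distrib] }) ?_ ?_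
  · intro u v
    simp [codeword_apply, doubled, add_mul, Finset.sum_add_distrib]
  · intro u hu x
    obtain ⟨i, hi⟩ := Function.ne_iff.1 hu
    obtain ⟨i, hi⟩ : ∃ i, u (Sum.inl i) ≠ 0 ∨ u (Sum.inr i) ≠ 0 := by
      rcases i with i | i
      · exact ⟨i, Or.inl hi⟩
      · exact ⟨i, Or.inr hi⟩
    have hne := smul_one_add_smul_ne_zero hw hi
    refine ⟨Pi.single i ((u (Sum.inl i) • (1 : F) + u (Sum.inr i) • w)⁻¹ * x), ?_⟩
    simp [Pi.single_apply, mul_inv_cancel_left₀ hne]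

lemma Equidistributed.circ_submatrix {A : Matrix κ ι F} (hA : Equidistributed (circ A))
    (e : κ' ≃ κ) (e' : ι' ≃ ι) : Equidistributed (circ (A.submatrix e e')) := by
  rw [AddCode.circ_submatrix]
  exact hA.submatrix e _

/-- In a codeword of an equidistributed matrix the proportion of nonzero symbols is `3 / 4`. -/
lemma Equidistributed.hammingNorm_eq (hF : Fintype.card F = 4) {A : Matrix κ ι F}
    (hA : Equidistributed A) {u : κ → ZMod 2} (hu : u ≠ 0) :
    4 * hammingNorm (codeword A u) = 3 * Fintype.card ι := by
  have h := hA u hu 0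
  have h' := Finset.card_filter_add_card_filter_not (s := Finset.univ)
    (fun j => codeword A u j = 0)
  rw [Finset.card_univ] at h'
  rw [hF] at h
  have : hammingNorm (codeword A u) = (Finset.univ.filter fun j => ¬ codeword A u j = 0).card := rfl
  omega

/-! ### Iteration steps and three-block matrices -/

/-- The columns of `(iterStep w A)°` are the columns of `A°` on top of the pairs `(β, w β)`. -/
lemma Equidistributed.circ_iterStep {w : F} (hw : w ^ 2 + w + 1 = 0) {A : Matrix κ ι F}
    (hA : Equidistributed (circ A)) : Equidistributed (circ (iterStep w A)) := by
  let f : Option ((ι × F) ⊕ {β : F // β ≠ 0}) → Option ι × (Unit → F) := fun o =>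
    o.elim (none, 0) (Sum.elim (fun p => (some p.1, fun _ => p.2)) fun β => (none, fun _ => β.1))
  have hf : Function.Bijective f := by
    constructor
    · clear hw hA
      rintro (_ | ⟨i, β⟩ | ⟨β, hβ⟩) (_ | ⟨i', β'⟩ | ⟨β', hβ'⟩) h <;>
        simp_all [f, funext_iff, eq_comm]
    · rintro ⟨_ | i, v⟩
      · by_cases hv : v () = 0
        · exact ⟨none, by ext <;> simp [f, hv]⟩
        · exact ⟨some (Sum.inr ⟨v (), hv⟩), rfl⟩
      · exact ⟨some (Sum.inl (i, v ())), rfl⟩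
  let e : Fin 2 ≃ Unit ⊕ Unit :=
    (finSumFinEquiv (m := 1) (n := 1)).symm.trans (Equiv.sumCongr (Equiv.ofUnique _ _) (Equiv.ofUnique _ _))
  have h : circ (iterStep w A) = (AddCode.starMul (circ A) (doubled (l := Unit) w)).submatrix
      (Equiv.sumCongr (Equiv.refl κ) e) (Equiv.ofBijective f hf) := by
    have e0 : e 0 = Sum.inl () := rfl
    have e1 : e 1 = Sum.inr () := rfl
    ext (i | i) (_ | p | β)
    on_goal 4 => fin_cases i
    on_goal 6 => fin_cases i
    on_goal 8 => fin_cases i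
    all_goals simp [circ, iterStep, AddCode.starMul, f, doubled, e0, e1]
  rw [h]
  exact (hA.starMul (equidistributed_doubled hw)).submatrix _ _

end Equidistributed

section FourElements

lemma w_ne_zero {w : F} (hw : w ^ 2 + w + 1 = 0) : w ≠ 0 := by
  rintro rfl
  simp at hw

lemma w_ne_one [CharP F 2] {w : F} (hw : w ^ 2 + w + 1 = 0) : w ≠ 1 := by
  rintro rfl
  have h2 : (1 : F) + 1 = 0 := CharTwo.add_self_eq_zero 1
  rw [one_pow, h2, zero_add] at hw
  exact one_ne_zero hw

lemma w_pow_injective [CharP F 2] {w : F} (hw : w ^ 2 + w + 1 = 0) :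
    Function.Injective fun r : Fin 3 => w ^ (r : ℕ) := by
  have h0 := w_ne_zero hw
  have h1 := w_ne_one hw
  have h2 : w ^ 2 ≠ 1 := fun h => h0 (by
    have h2 : (1 : F) + 1 = 0 := CharTwo.add_self_eq_zero 1
    linear_combination hw - h - h2)
  have h3 : w ^ 2 ≠ w := fun h => h1 (mul_left_cancel₀ h0 (by rw [← pow_two, h, mul_one]))
  intro r r' h
  fin_cases r <;> fin_cases r' <;> simp_all [eq_comm]

variable [Fintype F]

lemma eq_zero_or_eq_w_pow [CharP F 2] (hF : Fintype.card F = 4) {w : F}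
    (hw : w ^ 2 + w + 1 = 0) (x : F) : x = 0 ∨ ∃ r : Fin 3, x = w ^ (r : ℕ) := by
  classical
  have hc : (insert 0 (Finset.univ.image fun r : Fin 3 => w ^ (r : ℕ))).card = Fintype.card F := by
    rw [Finset.card_insert_of_notMem, Finset.card_image_of_injective _ (w_pow_injective hw), hF]
    · rfl
    · simp [w_ne_zero hw]
  have := (Finset.card_eq_iff_eq_univ _).1 hc ▸ Finset.mem_univ x
  simpa [eq_comm] using this

variable [DecidableEq F]

/-- The columns of the three blocks, together with one zero column, are the vectors `(v, w v)`:
every nonzero `v` is a unique scalar multiple of a unique column of `G`. -/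
lemma circ_threeBlock [CharP F 2] (hF : Fintype.card F = 4) {w : F} (hw : w ^ 2 + w + 1 = 0)
    {l s : ℕ} {G : Matrix (Fin l) (Fin s) F} (hG : IsSimplexGen G) :
    ∃ e : Option (Fin 3 × Fin s) ≃ (Fin l → F),
      circ (threeBlock w G) = (doubled w).submatrix id e := by
  have h0 := w_ne_zero hw
  let f : Option (Fin 3 × Fin s) → (Fin l → F) := fun o =>
    o.elim 0 fun p => w ^ (p.1 : ℕ) • G.col p.2
  have hne : ∀ p : Fin 3 × Fin s, w ^ (p.1 : ℕ) • G.col p.2 ≠ 0 := fun p =>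
    smul_ne_zero (pow_ne_zero _ h0) (hG.1 p.2)
  have hf : Function.Bijective f := by
    constructor
    · rintro (_ | ⟨r, j⟩) (_ | ⟨r', j'⟩) h
      · rfl
      · exact absurd h.symm (hne _)
      · exact absurd h (hne _)
      · have h' : w ^ (r : ℕ) • G.col j = w ^ (r' : ℕ) • G.col j' := h
        obtain rfl := (hG.2 _ (hne (r, j))).unique ⟨_, rfl⟩ ⟨_, h'⟩
        obtain ⟨i, hi⟩ := Function.ne_iff.1 (hG.1 j)
        have := w_pow_injective hw (mul_right_cancel₀ hi (congrFun h' i))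
        rw [this]
    · intro v
      by_cases hv : v = 0
      · exact ⟨none, hv.symm⟩
      obtain ⟨j, ⟨a, rfl⟩, -⟩ := hG.2 v hv
      rcases eq_zero_or_eq_w_pow hF hw a with rfl | ⟨r, rfl⟩
      · simp at hv
      · exact ⟨some (r, j), rfl⟩
  refine ⟨Equiv.ofBijective f hf, ?_⟩
  ext (i | i) (_ | p)
  all_goals simp [circ, threeBlock, doubled, f, pow_succ', mul_assoc]

lemma equidistributed_circ_threeBlock [CharP F 2] [Algebra (ZMod 2) F] (hF : Fintype.card F = 4) {w : F}
    (hw : w ^ 2 + w + 1 = 0) {l s : ℕ} {G : Matrix (Fin l) (Fin s) F} (hG : IsSimplexGen G) :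
    Equidistributed (circ (threeBlock w G)) := by
  obtain ⟨e, he⟩ := circ_threeBlock hF hw hG
  rw [he]
  exact (equidistributed_doubled hw).submatrix (Equiv.refl _) e

lemma three_mul_add_one_of_isSimplexGen [CharP F 2] (hF : Fintype.card F = 4) {w : F}
    (hw : w ^ 2 + w + 1 = 0) {l s : ℕ} {G : Matrix (Fin l) (Fin s) F} (hG : IsSimplexGen G) :
    3 * s + 1 = 4 ^ l := by
  obtain ⟨e, -⟩ := circ_threeBlock hF hw hG
  simpa [hF] using Fintype.card_congr e

end FourElements

/-! ### Additive symbol equal probability codes -/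

section ASEP

variable [DecidableEq F]

lemma hammingNorm_eq_sum [Fintype F] [CharP F 2] {ι : Type*} [Fintype ι] (hF : Fintype.card F = 4) {w : F}
    (hw : w ^ 2 + w + 1 = 0) (c : ι → F) :
    hammingNorm c = (Finset.univ.filter fun i => c i = 1).card +
      (Finset.univ.filter fun i => c i = w).card +
      (Finset.univ.filter fun i => c i = w ^ 2).card := by
  have h0 := w_ne_zero hw
  have hinj := w_pow_injective hw
  have hmaps : Set.MapsTo c (Finset.univ.filter fun i => c i ≠ 0 : Finset ι)
      (Finset.univ.image fun r : Fin 3 => w ^ (r : ℕ) : Finset F) := by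
    intro i hi
    have hi' : c i ≠ 0 := by simpa using hi
    obtain ⟨r, hr⟩ := (eq_zero_or_eq_w_pow hF hw (c i)).resolve_left hi'
    simpa using ⟨r, hr.symm⟩
  rw [hammingNorm, Finset.card_eq_sum_card_fiberwise hmaps,
    Finset.sum_image fun _ _ _ _ h => hinj h]
  have : ∀ r : Fin 3, (((Finset.univ.filter fun i => c i ≠ 0)).filter fun i =>
      c i = w ^ (r : ℕ)) = Finset.univ.filter fun i => c i = w ^ (r : ℕ) := by
    intro r
    ext i
    simp only [Finset.mem_filter, Finset.mem_univ, true_and, and_iff_right_iff_imp]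
    intro h
    rw [h]
    exact pow_ne_zero _ h0
  simp only [this, Fin.sum_univ_three]
  simp

lemma IsASEPGen.two_pow {w : F} {k n : ℕ} {A : Matrix (Fin k) (Fin n) F} (h : IsASEPGen w k A) :
    n + 1 = 2 ^ k := by
  have h1 := h.2.1
  rw [Fintype.card_fin] at h1
  have := Nat.one_le_two_pow (n := k)
  omega

lemma four_mul_three_mul {k : ℕ} (hk : 3 ≤ k) : 4 * (3 * 2 ^ (k - 2)) = 3 * 2 ^ k := by
  obtain ⟨k, rfl⟩ := Nat.exists_eq_add_of_le' hk
  rw [show k + 3 - 2 = k + 1 by omega]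
  ring

lemma IsIterated.two_pow [Fintype F] (hF : Fintype.card F = 4) {w : F}
    {k n : ℕ} {A : Matrix (Fin k) (Fin n) F} (h : IsIterated w k A) : n + 1 = 2 ^ k := by
  induction h with
  | base A hk hA => exact hA.two_pow
  | @step k n n' A _ e ih =>
    have h := Fintype.card_congr e
    simp [Fintype.card_subtype_compl, hF] at h
    rw [pow_add, ← ih]
    omega

variable [Fintype F] [Algebra (ZMod 2) F]

/-- The total weight of all codewords is at most `3 / 4` of the number of symbols, and the minimum
distance is such that only codes of constant weight attain this bound. -/
lemma IsASEPGen.hammingNorm_eq (hF : Fintype.card F = 4) {w : F} {k n : ℕ}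
    (hk : 3 ≤ k) {A : Matrix (Fin k) (Fin n) F} (h : IsASEPGen w k A) {u : Fin k → ZMod 2}
    (hu : u ≠ 0) : hammingNorm (codeword A u) = 3 * 2 ^ (k - 2) := by
  have hn := h.two_pow
  obtain ⟨-, -, hcard, hmin⟩ := h
  rw [logb_four_natCast_eq_iff Nat.card_pos] at hcard
  have hinj : Function.Injective (codeword A) := by
    let f : (Fin k → ZMod 2) → code A := fun u => ⟨codeword A u, (mem_code A _).2 ⟨u, rfl⟩⟩
    have hf : Function.Bijective f := by
      rw [Nat.bijective_iff_surjective_and_card]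
      refine ⟨?_, by simp [hcard]⟩
      rintro ⟨c, hc⟩
      obtain ⟨u, rfl⟩ := (mem_code A c).1 hc
      exact ⟨u, rfl⟩
    exact fun u v huv => hf.1 (Subtype.ext huv)
  have hle : ∀ u : Fin k → ZMod 2, u ≠ 0 → 3 * 2 ^ (k - 2) ≤ hammingNorm (codeword A u) :=
    fun u hu => hmin.2 ⟨_, (mem_code A _).2 ⟨u, rfl⟩, (map_ne_zero_iff _ hinj).2 hu, rfl⟩
  -- a column takes its values in a group of order at most `4`, so it vanishes on at least a quarter of all `u`
  have hcol : ∀ j, 4 * (Finset.univ.filter fun u => codeword A u j ≠ 0).card ≤ 3 * 2 ^ k := by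
    intro j
    have h1 := card_le_card_mul_card_fiber_zero
      ((Pi.evalAddMonoidHom (fun _ => F) j).comp (codeword A).toAddMonoidHom)
    have h2 := Finset.card_filter_add_card_filter_not (s := Finset.univ)
      (fun u => codeword A u j = 0)
    simp [hF] at h1 h2
    simp only [ne_eq]
    omega
  -- double counting of the nonzero symbols, by codewords and by positions
  have htotal : ∑ u, hammingNorm (codeword A u) =
      ∑ j, (Finset.univ.filter fun u => codeword A u j ≠ 0).card := by
    simp only [hammingNorm, Finset.card_filter]
    exact Finset.sum_comm
  have hupper : 4 * ∑ u, hammingNorm (codeword A u) ≤ n * (3 * 2 ^ k) := by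
    rw [htotal, Finset.mul_sum]
    refine (Finset.sum_le_card_nsmul _ _ _ fun j _ => hcol j).trans ?_
    simp
  by_contra hne
  have hlt : ∑ _u ∈ (Finset.univ.erase (0 : Fin k → ZMod 2)), 3 * 2 ^ (k - 2) <
      ∑ u ∈ Finset.univ.erase 0, hammingNorm (codeword A u) :=
    Finset.sum_lt_sum (fun u hu => hle u (Finset.ne_of_mem_erase hu))
      ⟨u, Finset.mem_erase.2 ⟨hu, Finset.mem_univ u⟩, lt_of_le_of_ne (hle u hu) (Ne.symm hne)⟩
  rw [Finset.sum_const, Finset.card_erase_of_mem (Finset.mem_univ _), Finset.card_univ,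
    Fintype.card_fun, ZMod.card, Fintype.card_fin, ← hn, Nat.add_sub_cancel, smul_eq_mul,
    Finset.sum_erase _ (by simp)] at hlt
  rw [← four_mul_three_mul hk] at hupper
  rw [mul_left_comm] at hupper
  omega

lemma IsASEPGen.equidistributed [CharP F 2] (hF : Fintype.card F = 4) {w : F} (hw : w ^ 2 + w + 1 = 0)
    {k n : ℕ} (hk : 3 ≤ k) {A : Matrix (Fin k) (Fin n) F} (h : IsASEPGen w k A) :
    Equidistributed (circ A) := by
  intro u hu x
  have hwt := h.hammingNorm_eq hF hk hu
  have hn := h.two_pow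
  have hk4 := four_mul_three_mul hk
  obtain ⟨h1, h2⟩ := h.1 (codeword A u) ((mem_code A _).2 ⟨u, rfl⟩)
  have hsum := hammingNorm_eq_sum hF hw (codeword A u)
  have hz := Finset.card_filter_add_card_filter_not (s := Finset.univ)
    (fun j => codeword A u j = 0)
  have hz' : hammingNorm (codeword A u) =
    (Finset.univ.filter fun j => ¬ codeword A u j = 0).card := rfl
  rw [Finset.card_univ, Fintype.card_fin] at hz
  rw [hF, Fintype.card_option, Fintype.card_fin, card_filter_option]
  simp only [codeword_circ_none, codeword_circ_some]
  rcases eq_zero_or_eq_w_pow hF hw x with rfl | ⟨r, rfl⟩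
  · rw [if_pos rfl]
    omega
  · rw [if_neg (pow_ne_zero _ (w_ne_zero hw)).symm]
    fin_cases r <;> simp only [pow_zero, pow_one] <;> omega

lemma IsIterated.equidistributed [CharP F 2] (hF : Fintype.card F = 4) {w : F} (hw : w ^ 2 + w + 1 = 0)
    {k n : ℕ} {A : Matrix (Fin k) (Fin n) F} (h : IsIterated w k A) :
    Equidistributed (circ A) := by
  induction h with
  | base A hk hA => exact hA.equidistributed hF hw hk
  | step A _ e ih => exact (ih.circ_iterStep hw).circ_submatrix _ _

/-- Together with `IsASEPGen.equidistributed`: an ASEP generator matrix with the standard parameters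
is the same as an equidistributed matrix with `2 ^ k` columns, without one zero column. -/
lemma isASEPGen_of_equidistributed (hF : Fintype.card F = 4) {w : F} (hw : w ^ 2 + w + 1 = 0)
    {k n : ℕ} (hk : 3 ≤ k) {A : Matrix (Fin k) (Fin n) F} (hn : n + 1 = 2 ^ k)
    (h : Equidistributed (circ A)) : IsASEPGen w k A := by
  have hk4 := four_mul_three_mul hk
  have hwt : ∀ u, u ≠ 0 → hammingNorm (codeword A u) = 3 * 2 ^ (k - 2) := by
    intro u hu
    have := h.hammingNorm_eq hF hu
    rw [hammingNorm_codeword_circ, Fintype.card_option, Fintype.card_fin, hn, ← hk4] at this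
    omega
  constructor
  · intro c hc
    obtain ⟨u, rfl⟩ := (mem_code A c).1 hc
    have h0 : w ≠ 0 := w_ne_zero hw
    by_cases hu : u = 0
    · subst hu
      simp [h0.symm, (pow_ne_zero 2 h0).symm]
    · have key : ∀ x : F, x ≠ 0 →
          4 * (Finset.univ.filter fun j => codeword A u j = x).card = n + 1 := by
        intro x hx
        have := h u hu x
        rw [hF, Fintype.card_option, Fintype.card_fin, card_filter_option] at this
        simpa [codeword_circ_none, codeword_circ_some, hx.symm] using this
      have h1 := key 1 one_ne_zero
      have h2 := key w h0
      have h3 := key (w ^ 2) (pow_ne_zero 2 h0)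
      omega
  · have := hasParams_code (A := A) (n := 2 ^ k - 1) (d := 3 * 2 ^ (k - 2))
      (by simp [← hn]) (by positivity) (fun u hu => (hwt u hu).ge)
      ⟨Pi.single ⟨0, by omega⟩ 1, by simp, hwt _ (by simp)⟩
    simpa using this

/-- For `k = 3`, the columns `t + w M t` with `t` binary generate an ASEP code, where `M` is the
companion matrix of `x ^ 3 + x + 1`. As `M` has no eigenvalue over the field with two elements,
no nonzero row vector `u` has `u` and `u M` linearly dependent, so `t ↦ u (t + w M t)` is onto. -/
lemma exists_isASEPGen_three [CharP F 2] (hF : Fintype.card F = 4) {w : F} (hw : w ^ 2 + w + 1 = 0) :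
    ∃ A : Matrix (Fin 3) (Fin 7) F, IsASEPGen w 3 A := by
  let M : (Fin 3 → ZMod 2) → Fin 3 → ZMod 2 := fun t => ![t 2, t 0 + t 2, t 1]
  let T : Matrix (Fin 3) (Fin 3 → ZMod 2) F := Matrix.of fun i t => t i • 1 + M t i • w
  have hT : Equidistributed T := by
    refine equidistributed_of_surjective (fun u =>
      { toFun := fun t => (∑ i, u i * t i) • (1 : F) + (∑ i, u i * M t i) • w
        map_zero' := by simp [M, Fin.sum_univ_three]
        map_add' := by
          intro t t'
          simp only [M, Fin.sum_univ_three, Pi.add_apply, Matrix.cons_val]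
          module }) ?_ ?_
    · intro u t
      simp only [codeword_apply, T, Matrix.of_apply, smul_add, smul_smul, Finset.sum_add_distrib,
        ← Finset.sum_smul]
      rfl
    · intro u hu x
      have key : ∀ u : Fin 3 → ZMod 2, u ≠ 0 → ∀ a b : ZMod 2, ∃ t : Fin 3 → ZMod 2,
          ∑ i, u i * t i = a ∧ ∑ i, u i * ![t 2, t 0 + t 2, t 1] i = b := by
        decide
      have hx : ∃ a b : ZMod 2, a • (1 : F) + b • w = x := by
        rcases eq_zero_or_eq_w_pow hF hw x with rfl | ⟨r, rfl⟩
        · exact ⟨0, 0, by simp⟩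
        fin_cases r
        · exact ⟨1, 0, by simp⟩
        · exact ⟨0, 1, by simp⟩
        · refine ⟨1, 1, ?_⟩
          simp only [one_smul]
          rw [← sub_eq_zero, CharTwo.sub_eq_add, ← hw]
          ring
      obtain ⟨a, b, rfl⟩ := hx
      obtain ⟨t, rfl, rfl⟩ := key u hu a b
      exact ⟨t, rfl⟩
  have e : Fin 7 ≃ {t : Fin 3 → ZMod 2 // t ≠ 0} :=
    Fintype.equivOfCardEq (by simp [Fintype.card_subtype_compl])
  refine ⟨Matrix.of fun i j => T i (e j).1,
    isASEPGen_of_equidistributed hF hw le_rfl (by norm_num) ?_⟩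
  have h := hT.submatrix (Equiv.refl _)
    ((Equiv.optionCongr e).trans (Equiv.optionSubtypeNe (0 : Fin 3 → ZMod 2)))
  convert h using 1
  ext i (_ | j) <;> simp [circ, T, M]
  fin_cases i <;> simp

lemma exists_isIterated [CharP F 2] (hF : Fintype.card F = 4) {w : F} (hw : w ^ 2 + w + 1 = 0) (j : ℕ) :
    ∃ (n : ℕ) (A : Matrix (Fin (2 * j + 3)) (Fin n) F), IsIterated w (2 * j + 3) A := by
  induction j with
  | zero =>
    obtain ⟨A, hA⟩ := exists_isASEPGen_three hF hw
    exact ⟨7, A, .base A le_rfl hA⟩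
  | succ j ih =>
    obtain ⟨n, A, hA⟩ := ih
    exact ⟨_, _, .step A hA (Fintype.equivFin _)⟩

end ASEP

/-- One representative of each point of the projective space. -/
lemma exists_isSimplexGen [Finite F] (l : ℕ) :
    ∃ (s : ℕ) (G : Matrix (Fin l) (Fin s) F), IsSimplexGen G := by
  obtain ⟨s, ⟨e⟩⟩ := Finite.exists_equiv_fin (Projectivization F (Fin l → F))
  refine ⟨s, Matrix.of fun i j => (e.symm j).rep i, fun j => (e.symm j).rep_nonzero, ?_⟩
  intro v hv
  refine ⟨e (Projectivization.mk F v hv), ?_, ?_⟩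
  · obtain ⟨a, ha⟩ := Projectivization.exists_smul_eq_mk_rep F v hv
    refine ⟨((a⁻¹ : Fˣ) : F), ?_⟩
    have : (Matrix.of fun i j => (e.symm j).rep i).col (e (Projectivization.mk F v hv)) =
        (Projectivization.mk F v hv).rep := by
      ext i; simp
    rw [this, ← ha]
    exact (inv_smul_smul a v).symm
  · rintro j ⟨a, ha⟩
    rw [← Equiv.symm_apply_eq, ← (e.symm j).mk_rep, eq_comm, Projectivization.mk_eq_mk_iff']
    exact ⟨a, ha.symm⟩

/-! ### The additive Griesmer bound -/

lemma ceil_div_two_pow_succ (D i : ℕ) :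
    ⌈(D : ℚ) / 2 ^ (i + 1)⌉₊ = ⌈(((D + 1) / 2 : ℕ) : ℚ) / 2 ^ i⌉₊ := by
  refine eq_of_forall_ge_iff fun n => ?_
  rw [Nat.ceil_le, Nat.ceil_le, div_le_iff₀ (by positivity), div_le_iff₀ (by positivity)]
  have h1 : (n : ℚ) * 2 ^ (i + 1) = ((n * 2 ^ i * 2 : ℕ) : ℚ) := by push_cast; ring
  have h2 : (n : ℚ) * 2 ^ i = ((n * 2 ^ i : ℕ) : ℚ) := by push_cast; ring
  rw [h1, h2, Nat.cast_le, Nat.cast_le]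
  omega

lemma griesmer_succ (K D : ℕ) : griesmer (K + 1) D = D + griesmer K ((D + 1) / 2) := by
  rw [griesmer, Finset.sum_range_succ', add_comm]
  congr 1
  · simp
  · exact Finset.sum_congr rfl fun i _ => ceil_div_two_pow_succ D i

lemma griesmer_mono (K : ℕ) {D D' : ℕ} (h : D ≤ D') : griesmer K D ≤ griesmer K D' :=
  Finset.sum_le_sum fun i _ => Nat.ceil_mono (by gcongr)

/-- The binary Griesmer bound. The positions are given by functionals `φ j` on an ambient space, a
code is a subspace `U`, and weights are taken on a set `S` of positions. The induction step
replaces `U` by a complement of a codeword `c` of minimum weight, and `S` by the zeros of `c`. -/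
lemma griesmer_le_card {V J : Type*} [AddCommGroup V] [Module (ZMod 2) V]
    [FiniteDimensional (ZMod 2) V] (φ : J → V →ₗ[ZMod 2] ZMod 2) (K : ℕ) :
    ∀ (D : ℕ) (U : Submodule (ZMod 2) V) (S : Finset J), Module.finrank (ZMod 2) U = K →
      (∀ v ∈ U, v ≠ 0 → D ≤ (S.filter fun j => φ j v ≠ 0).card) → griesmer K D ≤ S.card := by
  induction K with
  | zero => intros; exact Nat.zero_le _
  | succ K ih =>
    intro D U S hU hD
    have hne : ∃ c ∈ U, c ≠ 0 := by
      rw [← Submodule.ne_bot_iff]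
      rintro rfl
      simp at hU
    obtain ⟨c, ⟨hcU, hc0⟩, hmin⟩ := exists_minimalFor_of_wellFoundedLT
      (fun c => c ∈ U ∧ c ≠ 0) (fun c => (S.filter fun j => φ j c ≠ 0).card) hne
    set W := (S.filter fun j => φ j c ≠ 0).card with hW
    have hmin' : ∀ v ∈ U, v ≠ 0 → W ≤ (S.filter fun j => φ j v ≠ 0).card := by
      intro v hv hv0
      by_contra! h
      exact absurd (hmin ⟨hv, hv0⟩ h.le) (not_le.2 h)
    obtain ⟨U', hcU', hinf⟩ : ∃ U' : Submodule (ZMod 2) V, U' ⊔ Submodule.span (ZMod 2) {c} = U ∧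
        Disjoint U' (Submodule.span (ZMod 2) {c}) := by
      obtain ⟨Q, hQ⟩ := exists_isCompl (Submodule.span (ZMod 2) {c})
      refine ⟨Q ⊓ U, ?_, hQ.disjoint.symm.mono_left inf_le_left⟩
      rw [sup_comm, ← sup_inf_assoc_of_le _ ((Submodule.span_singleton_le_iff_mem c U).2 hcU),
        hQ.sup_eq_top, top_inf_eq]
    have hU' : Module.finrank (ZMod 2) U' = K := by
      have h := Submodule.finrank_sup_add_finrank_inf_eq U' (Submodule.span (ZMod 2) {c})
      rw [hcU', hinf.eq_bot, finrank_bot, finrank_span_singleton hc0, hU] at h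
      omega
    have hle : U' ≤ U := hcU' ▸ le_sup_left
    -- weights split into the parts on the support of `c` and on its zeros
    have hsplit : ∀ v, (S.filter fun j => φ j v ≠ 0).card =
        ((S.filter fun j => φ j c ≠ 0).filter fun j => φ j v ≠ 0).card +
        ((S.filter fun j => φ j c = 0).filter fun j => φ j v ≠ 0).card := by
      intro v
      have h := Finset.card_filter_add_card_filter_not (s := S.filter fun j => φ j v ≠ 0)
        (fun j => φ j c = 0)
      rw [← h, add_comm]
      simp only [Finset.filter_filter, and_comm, ne_eq]
    have hres := ih ((W + 1) / 2) U' (S.filter fun j => φ j c = 0) hU' fun v hv hv0 => by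
      have hvc : v + c ≠ 0 := by
        intro h
        have hcv : c = -v := (neg_eq_of_add_eq_zero_right h).symm
        exact hv0 (Submodule.disjoint_def.1 hinf v hv (by
          rw [← neg_mem_iff, ← hcv]; exact Submodule.mem_span_singleton_self c))
      -- on the support of `c`, exactly one of `v` and `v + c` is nonzero in each position
      have h1 := hmin' v (hle hv) hv0
      have h2 := hmin' (v + c) (U.add_mem (hle hv) hcU) hvc
      rw [hsplit] at h1 h2
      have h3 : ((S.filter fun j => φ j c = 0).filter fun j => φ j (v + c) ≠ 0) =
          (S.filter fun j => φ j c = 0).filter fun j => φ j v ≠ 0 := by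
        refine Finset.filter_congr fun j hj => ?_
        rw [map_add, (Finset.mem_filter.1 hj).2, add_zero]
      have h4 : ((S.filter fun j => φ j c ≠ 0).filter fun j => φ j (v + c) ≠ 0) =
          (S.filter fun j => φ j c ≠ 0).filter fun j => ¬ φ j v ≠ 0 := by
        refine Finset.filter_congr fun j hj => ?_
        have key : ∀ x y : ZMod 2, y ≠ 0 → (x + y ≠ 0 ↔ ¬ x ≠ 0) := by decide
        rw [map_add]
        exact key _ _ (Finset.mem_filter.1 hj).2
      have h5 := Finset.card_filter_add_card_filter_not
        (s := S.filter fun j => φ j c ≠ 0) (fun j => φ j v ≠ 0)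
      rw [h3, h4] at h2
      omega
    have hS := Finset.card_filter_add_card_filter_not (s := S) (fun j => φ j c = 0)
    calc griesmer (K + 1) D ≤ griesmer (K + 1) W := griesmer_mono _ (hD c hcU hc0)
      _ = W + griesmer K ((W + 1) / 2) := griesmer_succ K W
      _ ≤ S.card := by
        have hS' : (S.filter fun j => ¬ φ j c = 0).card = W := rfl
        omega

/-- The additive Griesmer bound: replacing each quaternary symbol `x` by the three bits
`Tr (a x)`, `a ≠ 0`, of which exactly two are nonzero if `x ≠ 0`, gives a binary code. -/
lemma HasParams.griesmer_le [Fintype F] [DecidableEq F] [Algebra (ZMod 2) F]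
    (hF : Fintype.card F = 4) {ι : Type*} [Fintype ι] {C : AddSubgroup (ι → F)} {n K d : ℕ}
    (h : HasParams C n ((K : ℝ) / 2) d) : griesmer K (2 * d) ≤ 3 * n := by
  classical
  obtain ⟨hn, hcard, hmin⟩ := h
  rw [logb_four_natCast_eq_iff Nat.card_pos] at hcard
  let φ : ι × F → (ι → F) →ₗ[ZMod 2] ZMod 2 := fun p =>
    (Algebra.trace (ZMod 2) F).comp
      ((LinearMap.mulLeft (ZMod 2) p.2).comp (LinearMap.proj p.1))
  have hφ : ∀ p v, φ p v = Algebra.trace (ZMod 2) F (p.2 * v p.1) := fun p v => rfl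
  let U : Submodule (ZMod 2) (ι → F) := AddSubgroup.toZModSubmodule 2 C
  have hU : Module.finrank (ZMod 2) U = K := by
    have h1 : Nat.card U = 2 ^ K := hcard
    rw [Module.natCard_eq_pow_finrank (K := ZMod 2), Nat.card_zmod] at h1
    exact Nat.pow_right_injective le_rfl h1
  -- the positions `(i, a)` with `a ≠ 0`
  have hS : ((Finset.univ : Finset ι) ×ˢ (Finset.univ.erase (0 : F))).card = 3 * n := by
    rw [Finset.card_product, Finset.card_erase_of_mem (Finset.mem_univ _), Finset.card_univ,
      Finset.card_univ, hF, hn, mul_comm]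
  have htr : Function.Surjective (Algebra.trace (ZMod 2) F) := Algebra.trace_surjective _ _
  have hbits : ∀ x : F, ((Finset.univ.erase (0 : F)).filter fun a =>
      Algebra.trace (ZMod 2) F (a * x) ≠ 0).card = if x ≠ 0 then 2 else 0 := by
    intro x
    split_ifs with hx
    · have h1 := card_mul_card_fiber ((Algebra.trace (ZMod 2) F).toAddMonoidHom.comp
        (AddMonoidHom.mulRight x)) (by
          intro y
          obtain ⟨z, rfl⟩ := htr y
          exact ⟨z * x⁻¹, by simp [hx]⟩) 1
      rw [ZMod.card, hF] at h1
      have key : ∀ y : ZMod 2, y ≠ 0 ↔ y = 1 := by decide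
      have h2 : ((Finset.univ.erase (0 : F)).filter fun a =>
          Algebra.trace (ZMod 2) F (a * x) ≠ 0) =
          Finset.univ.filter fun a => Algebra.trace (ZMod 2) F (a * x) = 1 := by
        ext a
        simp only [Finset.mem_filter, Finset.mem_erase, Finset.mem_univ, and_true, true_and, key]
        refine ⟨fun h => h.2, fun h => ⟨?_, h⟩⟩
        rintro rfl
        simp at h
      rw [h2]
      change 2 * (Finset.univ.filter fun a => Algebra.trace (ZMod 2) F (a * x) = 1).card = 4 at h1
      omega
    · simp [not_not.1 hx]
  rw [← hS]
  refine griesmer_le_card φ K (2 * d) U _ hU fun v hv hv0 => ?_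
  have hd : d ≤ hammingNorm v := hmin.2 ⟨v, hv, hv0, rfl⟩
  have hw : (((Finset.univ : Finset ι) ×ˢ (Finset.univ.erase (0 : F))).filter fun p =>
      φ p v ≠ 0).card = 2 * hammingNorm v := by
    rw [Finset.card_filter, Finset.sum_product]
    simp only [hφ, ← Finset.card_filter, hbits]
    rw [← Finset.sum_filter, Finset.sum_const, smul_eq_mul, mul_comm]
    rfl
  omega

/-! ### Values of the Griesmer sum -/

lemma griesmer_succ_two_mul (K D : ℕ) : griesmer (K + 1) (2 * D) = 2 * D + griesmer K D := by
  rw [griesmer_succ]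
  congr 2
  omega

/-- The first `a` halvings are exact, each contributing a term `2 ^ i * E` with `1 ≤ i ≤ a`. -/
lemma griesmer_two_pow_mul (a b E : ℕ) :
    griesmer (a + b) (2 ^ a * E) + 2 * E = 2 ^ (a + 1) * E + griesmer b E := by
  induction a with
  | zero => simp; ring
  | succ a ih =>
    rw [show a + 1 + b = a + b + 1 by ring, pow_succ' 2 a, mul_assoc, griesmer_succ_two_mul]
    linear_combination ih

/-- As for `2 ^ a * E`, but the summand `1` survives every rounded halving. -/
lemma griesmer_two_pow_mul_add_one (a b E : ℕ) :
    griesmer (a + b) (2 ^ a * E + 1) + 2 * E = 2 ^ (a + 1) * E + a + griesmer b (E + 1) := by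
  induction a with
  | zero => simp; ring
  | succ a ih =>
    have h : (2 ^ (a + 1) * E + 1 + 1) / 2 = 2 ^ a * E + 1 := by
      rw [pow_succ', mul_assoc]
      omega
    rw [show a + 1 + b = a + b + 1 by ring, griesmer_succ, h]
    linear_combination ih

lemma griesmer_three_mul_two_pow (b : ℕ) : griesmer (b + 1) (3 * 2 ^ b) + 3 = 6 * 2 ^ b := by
  induction b with
  | zero => simp [griesmer]
  | succ b ih =>
    rw [pow_succ', mul_left_comm, griesmer_succ_two_mul]
    linear_combination ih

lemma griesmer_three_mul_two_pow_sub_one (b : ℕ) :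
    griesmer (b + 2) (3 * 2 ^ (b + 1) - 1) + 4 = 6 * 2 ^ (b + 1) := by
  have h := griesmer_three_mul_two_pow b
  have hp := Nat.one_le_two_pow (n := b)
  rw [griesmer_succ, show (3 * 2 ^ (b + 1) - 1 + 1) / 2 = 3 * 2 ^ b by rw [pow_succ]; omega, pow_succ]
  omega

lemma griesmer_three_mul_two_pow_sub_two (b : ℕ) :
    griesmer (b + 3) (3 * 2 ^ (b + 2) - 2) + 6 = 6 * 2 ^ (b + 2) := by
  have h := griesmer_three_mul_two_pow_sub_one b
  have hp := Nat.one_le_two_pow (n := b)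
  rw [griesmer_succ, show (3 * 2 ^ (b + 2) - 2 + 1) / 2 = 3 * 2 ^ (b + 1) - 1 by
    rw [pow_succ, pow_succ]; omega, pow_succ _ (b + 1)]
  have hp' := Nat.one_le_two_pow (n := b + 1)
  omega

lemma griesmer_three_mul_two_pow_sub_three (b : ℕ) :
    griesmer (b + 3) (3 * 2 ^ (b + 2) - 3) + 7 = 6 * 2 ^ (b + 2) := by
  have h := griesmer_three_mul_two_pow_sub_one b
  have hp := Nat.one_le_two_pow (n := b)
  rw [griesmer_succ, show (3 * 2 ^ (b + 2) - 3 + 1) / 2 = 3 * 2 ^ (b + 1) - 1 by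
    rw [pow_succ, pow_succ]; omega, pow_succ _ (b + 1)]
  have hp' := Nat.one_le_two_pow (n := b + 1)
  omega

/-- The parameters of a code are unique. -/
lemma isGriesmer_iff [DecidableEq F] {ι : Type*} [Fintype ι] {C : AddSubgroup (ι → F)} {n K d : ℕ}
    (h : HasParams C n ((K : ℝ) / 2) d) : IsGriesmer C ↔ 3 * n = griesmer K (2 * d) := by
  refine ⟨?_, fun h' => ⟨n, K, d, h, h'⟩⟩
  rintro ⟨n', K', d', ⟨hn, hK, hd⟩, hg⟩
  obtain rfl := hn.symm.trans h.1
  obtain rfl := hd.unique h.2.2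
  have hKK : (K' : ℝ) / 2 = K / 2 := hK.symm.trans h.2.1
  obtain rfl : K' = K := by
    rw [div_left_inj' two_ne_zero] at hKK
    exact_mod_cast hKK
  exact hg

/-- The Griesmer sum at `2 d`, for the length `n` and the minimum distance `d = 2 ^ c * E` of the
anticode construction, where `k₁ = b + 2` and `k₂ = c + 2`. -/
lemma griesmer_code_eq_iff {b c m E n s : ℕ} (hm₁ : 1 ≤ m) (hm₃ : m ≤ 3)
    (hE : E + m = 3 * 2 ^ (b + 2)) (hs : 3 * s + 1 = 2 ^ (c + 2))
    (hn : n + m * s + 1 = 2 ^ (b + 2) * (3 * s + 1)) :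
    3 * n = griesmer (c + (b + 4)) (2 * (2 ^ c * E)) ↔ m = 1 := by
  have h3n : 3 * n + 3 = 2 ^ (c + 2) * E + m := by
    rw [← hs] at *
    linear_combination 3 * hn - (3 * s + 1) * hE
  have hg := griesmer_two_pow_mul (c + 1) (b + 3) E
  rw [show c + 1 + (b + 3) = c + (b + 4) by ring, pow_succ', mul_assoc] at hg
  have h1 := griesmer_three_mul_two_pow_sub_one (b + 1)
  have h2 := griesmer_three_mul_two_pow_sub_two b
  have h3 := griesmer_three_mul_two_pow_sub_three b
  have hE' : griesmer (b + 3) E = griesmer (b + 3) (3 * 2 ^ (b + 2) - m) := by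
    rw [← hE, Nat.add_sub_cancel]
  rw [show c + 1 + 1 = c + 2 by ring, hE'] at hg
  clear hE' hn hs
  interval_cases m <;> simp only [add_assoc, Nat.reduceAdd, iff_true] at * <;> omega

/-- The Griesmer sum at `2 d + 2`, for the length `n` and the minimum distance `d = 2 ^ c * E` of
the anticode construction, where `k₁ = b + 2` and `k₂ = c + 2`. -/
lemma lt_griesmer_code {b c m E n s : ℕ} (hc : 2 ≤ c) (hm₁ : 1 ≤ m) (hm₃ : m ≤ 3)
    (hE : E + m = 3 * 2 ^ (b + 2)) (hs : 3 * s + 1 = 2 ^ (c + 2))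
    (hn : n + m * s + 1 = 2 ^ (b + 2) * (3 * s + 1)) :
    3 * n + 3 < griesmer (c + (b + 4)) (2 * (2 ^ c * E) + 2) := by
  have h3n : 3 * n + 3 = 2 ^ (c + 2) * E + m := by
    rw [← hs] at *
    linear_combination 3 * hn - (3 * s + 1) * hE
  rw [show c + (b + 4) = c + (b + 3) + 1 by ring,
    show 2 * (2 ^ c * E) + 2 = 2 * (2 ^ c * E + 1) by ring, griesmer_succ_two_mul]
  have hg := griesmer_two_pow_mul_add_one c (b + 3) E
  have h0 := griesmer_three_mul_two_pow (b + 2)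
  have h1 := griesmer_three_mul_two_pow_sub_one (b + 1)
  have h2 := griesmer_three_mul_two_pow_sub_two b
  have hp : 1 ≤ 2 ^ (b + 2) := Nat.one_le_two_pow
  have hpow : 2 ^ (c + 2) * E = 2 ^ (c + 1) * E + 2 * (2 ^ c * E) := by ring
  obtain hE' : E + 1 = 3 * 2 ^ (b + 2) - (m - 1) := by omega
  rw [hE'] at hg
  clear hE' hn hs
  interval_cases m <;> simp only [add_assoc, Nat.reduceAdd, Nat.reduceSub, Nat.sub_zero] at * <;>
    omega

/-! ### The combined matrix and the anticode -/

lemma gens_le_gens {R κ ι ι' : Type*} [Fintype ι] [Fintype ι'] {A : Matrix κ ι R}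
    {B : Matrix κ ι' R} (f : ι ↪ ι') (h : ∀ j, A.col j = B.col (f j)) : gens A ≤ gens B := by
  have : gens A = ((Finset.univ.map f).val).map B.col := by
    rw [Finset.map_val, Multiset.map_map]
    exact Multiset.map_congr rfl fun j _ => h j
  rw [this]
  exact Multiset.map_le_map (Finset.val_le_iff.2 (Finset.subset_univ _))

lemma gens_anticode_le {k₁ n₁ l s : ℕ} (A : Matrix (Fin k₁) (Fin n₁) F) (w : F)
    [Fintype {p : Option (Fin n₁) × Option (Fin 3 × Fin s) // p ≠ (none, none)}]
    (G : Matrix (Fin l) (Fin s) F) (m : ℕ) :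
    gens (anticode k₁ w G m) ≤ gens (combine A (threeBlock w G)) := by
  refine gens_le_gens ⟨fun p => ⟨(none, some (p.1.1, p.2)), by simp⟩, ?_⟩ ?_
  · rintro ⟨r, j⟩ ⟨r', j'⟩ h
    simpa [Subtype.ext_iff, Prod.ext_iff] using h
  · intro p
    ext (i | i) <;> rfl

/-- The column removed from `A° ⋆ B°` is the zero column that `circ` appends again. -/
lemma Equidistributed.circ_combine [Fintype F] [DecidableEq F] [Algebra (ZMod 2) F]
    {κ₁ κ₂ ι₁ ι₂ : Type*} [Fintype κ₁] [Fintype κ₂] [Fintype ι₁] [Fintype ι₂]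
    [DecidableEq ι₁] [DecidableEq ι₂] {A : Matrix κ₁ ι₁ F}
    {B : Matrix κ₂ ι₂ F} (hA : Equidistributed (circ A)) (hB : Equidistributed (circ B)) :
    Equidistributed (circ (combine A B)) := by
  have h : circ (combine A B) = (AddCode.starMul (circ A) (circ B)).submatrix (Equiv.refl _)
      (Equiv.optionSubtypeNe (none, none)) := by
    ext (i | i) (_ | p) <;> simp [circ, combine, AddCode.starMul]
  rw [h]
  exact (hA.starMul hB).submatrix _ _

section Anticode

variable [Algebra (ZMod 2) F] {l s : ℕ}

lemma codeword_threeBlock (w : F) (G : Matrix (Fin l) (Fin s) F)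
    (u : Fin l ⊕ Fin l → ZMod 2) (p : Fin 3 × Fin s) :
    codeword (threeBlock w G) u p = w ^ (p.1 : ℕ) * codeword (threeBlock w G) u (0, p.2) := by
  simp [codeword_apply, threeBlock, mul_add, Finset.mul_sum, pow_succ, mul_assoc]

lemma codeword_anticode {k₁ m : ℕ} (w : F) (G : Matrix (Fin l) (Fin s) F)
    (u : Fin k₁ ⊕ (Fin l ⊕ Fin l) → ZMod 2) (p : {r : Fin 3 // (r : ℕ) < m} × Fin s) :
    codeword (anticode k₁ w G m) u p =
      codeword (threeBlock w G) (u ∘ Sum.inr) (p.1.1, p.2) := by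
  simp [codeword_apply, anticode]

lemma card_fin_three_lt {m : ℕ} (hm : m ≤ 3) : Fintype.card {r : Fin 3 // (r : ℕ) < m} = m := by
  interval_cases m <;> rfl

/-- Multiplying a block by `w` does not change weights, so every block contributes equally. -/
lemma hammingNorm_codeword_anticode [Fintype F] [DecidableEq F] [CharP F 2] (hF : Fintype.card F = 4) {w : F}
    (hw : w ^ 2 + w + 1 = 0) {G : Matrix (Fin l) (Fin s) F} (hG : IsSimplexGen G) {k₁ m : ℕ}
    (hm : m ≤ 3) {u : Fin k₁ ⊕ (Fin l ⊕ Fin l) → ZMod 2} (hu : u ∘ Sum.inr ≠ 0) :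
    4 * hammingNorm (codeword (anticode k₁ w G m) u) = m * 4 ^ l := by
  have hrow : ∀ r : Fin 3,
      (Finset.univ.filter fun j => codeword (threeBlock w G) (u ∘ Sum.inr) (r, j) ≠ 0).card =
      (Finset.univ.filter fun j => codeword (threeBlock w G) (u ∘ Sum.inr) (0, j) ≠ 0).card := by
    intro r
    congr 1
    refine Finset.filter_congr fun j _ => ?_
    rw [codeword_threeBlock]
    exact mul_ne_zero_iff_left (pow_ne_zero _ (w_ne_zero hw))
  have h1 : hammingNorm (codeword (anticode k₁ w G m) u) = m *
      (Finset.univ.filter fun j => codeword (threeBlock w G) (u ∘ Sum.inr) (0, j) ≠ 0).card := by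
    rw [hammingNorm, Finset.card_filter, Fintype.sum_prod_type]
    simp only [codeword_anticode, ← Finset.card_filter]
    rw [Finset.sum_congr rfl fun r _ => hrow r.1, Finset.sum_const, Finset.card_univ,
      card_fin_three_lt hm, smul_eq_mul]
  have h2 : hammingNorm (codeword (threeBlock w G) (u ∘ Sum.inr)) = 3 *
      (Finset.univ.filter fun j => codeword (threeBlock w G) (u ∘ Sum.inr) (0, j) ≠ 0).card := by
    rw [hammingNorm, Finset.card_filter, Fintype.sum_prod_type]
    simp only [← Finset.card_filter]
    rw [Finset.sum_congr rfl fun r _ => hrow r, Finset.sum_const, Finset.card_univ,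
      Fintype.card_fin, smul_eq_mul]
  have h3 := (equidistributed_circ_threeBlock hF hw hG).hammingNorm_eq hF hu
  rw [hammingNorm_codeword_circ, h2, Fintype.card_option, Fintype.card_prod, Fintype.card_fin,
    Fintype.card_fin, three_mul_add_one_of_isSimplexGen hF hw hG] at h3
  rw [h1, mul_left_comm]
  congr 1
  omega

lemma hammingNorm_codeword_anticode_of_eq_zero [DecidableEq F] {w : F} {G : Matrix (Fin l) (Fin s) F} {k₁ m : ℕ}
    {u : Fin k₁ ⊕ (Fin l ⊕ Fin l) → ZMod 2} (hu : u ∘ Sum.inr = 0) :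
    hammingNorm (codeword (anticode k₁ w G m) u) = 0 := by
  rw [hammingNorm_eq_zero]
  ext p
  simp [codeword_anticode, hu]

end Anticode

end AddCode

theorem mainTheorem6 {F : Type*} [Field F] [Fintype F] [DecidableEq F]
    (hF : Fintype.card F = 4) (w : F) (hw : w ^ 2 + w + 1 = 0)
    (k k₁ k₂ l m : ℕ) (hk : k = k₁ + k₂) (hk₁ : 3 ≤ k₁) (hk₁odd : Odd k₁)
    (hk₂ : 4 ≤ k₂) (hk₂l : k₂ = 2 * l) (hm₁ : 1 ≤ m) (hm₃ : m ≤ 3) :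
    (∃ (n₁ : ℕ) (A₁ : Matrix (Fin k₁) (Fin n₁) F), AddCode.IsIterated w k₁ A₁) ∧
    (∃ (s : ℕ) (G : Matrix (Fin l) (Fin s) F), AddCode.IsSimplexGen G) ∧
    ∀ (n₁ s : ℕ) (A₁ : Matrix (Fin k₁) (Fin n₁) F) (G : Matrix (Fin l) (Fin s) F),
      AddCode.IsIterated w k₁ A₁ → AddCode.IsSimplexGen G →
      AddCode.gens (AddCode.anticode k₁ w G m) ≤
          AddCode.gens (AddCode.combine A₁ (AddCode.threeBlock w G)) ∧
      ∀ (n : ℕ) (B : Matrix (Fin k₁ ⊕ (Fin l ⊕ Fin l)) (Fin n) F),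
        AddCode.gens B = AddCode.gens (AddCode.combine A₁ (AddCode.threeBlock w G)) -
          AddCode.gens (AddCode.anticode k₁ w G m) →
        AddCode.IsTWeight (AddCode.code B) 2 ∧
        AddCode.HasParams (AddCode.code B) (2 ^ k - 1 - m * ((2 ^ k₂ - 1) / 3)) ((k : ℝ) / 2)
          (3 * 2 ^ (k - 2) - m * 2 ^ (k₂ - 2)) ∧
        AddCode.weightDistribution (AddCode.code B) =
          1 + (2 ^ k - 2 ^ k₁) * Polynomial.X ^ (3 * 2 ^ (k - 2) - m * 2 ^ (k₂ - 2))
            + (2 ^ k₁ - 1) * Polynomial.X ^ (3 * 2 ^ (k - 2)) ∧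
        AddCode.IsGPO (AddCode.code B) ∧
        (AddCode.IsGriesmer (AddCode.code B) ↔ m = 1) := by
  have : CharP F 2 := by
    refine CharTwo.of_one_ne_zero_of_two_eq_zero one_ne_zero ?_
    have h4 := FiniteField.cast_card_eq_zero F
    rw [hF] at h4
    have : (2 : F) * 2 = 0 := by rw [← h4]; norm_num
    exact mul_self_eq_zero.1 this
  let _ : Algebra (ZMod 2) F := ZMod.algebra F 2
  refine ⟨?_, AddCode.exists_isSimplexGen l, fun n₁ s A₁ G hA₁ hG =>
    ⟨AddCode.gens_anticode_le A₁ w G m, fun n B hB => ?_⟩⟩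
  · obtain ⟨j, rfl⟩ := hk₁odd
    obtain ⟨j, rfl⟩ := Nat.exists_eq_add_of_le' (show 1 ≤ j by omega)
    exact AddCode.exists_isIterated hF hw j
  have hs := AddCode.three_mul_add_one_of_isSimplexGen hF hw hG
  have hn₁ := hA₁.two_pow hF
  have hcomb := (hA₁.equidistributed hF hw).circ_combine
    (AddCode.equidistributed_circ_threeBlock hF hw hG)
  have hadd : AddCode.gens B + AddCode.gens (AddCode.anticode k₁ w G m) =
      AddCode.gens (AddCode.combine A₁ (AddCode.threeBlock w G)) := by
    rw [hB]
    exact tsub_add_cancel_of_le (AddCode.gens_anticode_le A₁ w G m)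
  have hcard : Fintype.card {p : Option (Fin n₁) × Option (Fin 3 × Fin s) // p ≠ (none, none)} + 1 =
      2 ^ k₁ * (3 * s + 1) := by
    rw [← Fintype.card_option, Fintype.card_congr (Equiv.optionSubtypeNe _)]
    simp [hn₁]
  -- writing `k₁ = b + 2` and `k₂ = c + 2` removes the truncated subtractions from the exponents
  obtain ⟨b, rfl⟩ := Nat.exists_eq_add_of_le' (show 2 ≤ k₁ by omega)
  obtain ⟨c, rfl⟩ := Nat.exists_eq_add_of_le' (show 2 ≤ k₂ by omega)
  have hs4 : 4 ^ l = 2 ^ (c + 2) := by rw [hk₂l, pow_mul]; norm_num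
  rw [hs4] at hs
  have hn : n + m * s + 1 = 2 ^ (b + 2) * (3 * s + 1) := by
    have h := congrArg Multiset.card hadd
    simp only [AddCode.gens, Multiset.card_add, Multiset.card_map, Finset.card_val,
      Finset.card_univ, Fintype.card_prod, Fintype.card_fin, AddCode.card_fin_three_lt hm₃] at h
    rw [h, hcard]
  -- weights add up along generator multisets
  have hwt : ∀ u, 4 * hammingNorm (AddCode.codeword B u) +
      4 * hammingNorm (AddCode.codeword (AddCode.anticode (b + 2) w G m) u) =
      4 * hammingNorm (AddCode.codeword (AddCode.combine A₁ (AddCode.threeBlock w G)) u) := by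
    intro u
    simp only [AddCode.hammingNorm_codeword, ← hadd, Multiset.countP_add]
    ring
  have hwt_comb : ∀ u, u ≠ 0 → 4 * hammingNorm
      (AddCode.codeword (AddCode.combine A₁ (AddCode.threeBlock w G)) u) =
        3 * (2 ^ (b + 2) * 2 ^ (c + 2)) := by
    intro u hu
    rw [← AddCode.hammingNorm_codeword_circ, hcomb.hammingNorm_eq hF hu, Fintype.card_option,
      hcard, hs]
  -- `3 * 2 ^ k₁ - m`, a factor of the minimum distance `2 ^ c * E`
  obtain ⟨E, hE⟩ : ∃ E, E + m = 3 * 2 ^ (b + 2) :=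
    ⟨_, Nat.sub_add_cancel (by have := Nat.one_le_two_pow (n := b + 2); omega)⟩
  have hE1 : 1 ≤ E := by have := Nat.one_le_two_pow (n := b); rw [pow_add] at hE; omega
  have hEc : 2 ^ c * E + m * 2 ^ c = 3 * 2 ^ (b + 2 + c) := by
    rw [pow_add]
    linear_combination 2 ^ c * hE
  have hkc : k - 2 = b + 2 + c := by omega
  have ha : 3 * 2 ^ (k - 2) - m * 2 ^ (c + 2 - 2) = 2 ^ c * E := by
    rw [hkc, Nat.add_sub_cancel]
    omega
  have hlen : 2 ^ k - 1 - m * ((2 ^ (c + 2) - 1) / 3) = n := by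
    rw [← hs, Nat.add_sub_cancel, Nat.mul_div_cancel_left _ (by norm_num), hk, pow_add, ← hs]
    omega
  have hc4 : 4 ≤ 2 ^ c := Nat.pow_le_pow_right (n := 2) two_pos (show 2 ≤ c by omega)
  have ha4 : 4 ≤ 2 ^ c * E := hc4.trans (Nat.le_mul_of_pos_right _ hE1)
  have : NeZero l := ⟨by omega⟩
  obtain ⟨htw, hpar, hdist⟩ := AddCode.two_weight_code (A := B) (a := 2 ^ c * E)
    (b := 3 * 2 ^ (k - 2)) (by omega)
    (by rw [hkc, ← hEc]; exact Nat.lt_add_of_pos_right (by positivity))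
    (fun u hu => by
      have h1 := hwt u
      have h2 := AddCode.hammingNorm_codeword_anticode hF hw hG hm₃ hu
      rw [hwt_comb u (by rintro rfl; exact hu rfl), h2, hs4] at h1
      have h3 : 3 * (2 ^ (b + 2) * 2 ^ (c + 2)) = 4 * (2 ^ c * E) + m * 2 ^ (c + 2) := by
        calc 3 * (2 ^ (b + 2) * 2 ^ (c + 2)) = 3 * 2 ^ (b + 2) * 2 ^ (c + 2) := by ring
          _ = 4 * (2 ^ c * E) + m * 2 ^ (c + 2) := by rw [← hE]; ring
      omega)
    (fun u hu hu' => by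
      have h1 := hwt u
      rw [hwt_comb u hu, AddCode.hammingNorm_codeword_anticode_of_eq_zero hu'] at h1
      have h3 : 3 * (2 ^ (b + 2) * 2 ^ (c + 2)) = 4 * (3 * 2 ^ (k - 2)) := by
        rw [hkc]; ring
      omega)
  have hκ : Fintype.card (Fin (b + 2)) + Fintype.card (Fin l ⊕ Fin l) = k := by
    simp only [Fintype.card_fin, Fintype.card_sum]
    omega
  rw [hκ, Fintype.card_fin] at hpar hdist
  have hkk : k = c + (b + 4) := by omega
  have hgpo := AddCode.lt_griesmer_code (by omega) hm₁ hm₃ hE hs hn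
  rw [ha, hlen]
  refine ⟨htw, hpar, hdist, ?_, ?_⟩
  · have han : 2 ^ c * E < n := by
      have h1 : 3 * n + 3 = 4 * (2 ^ c * E) + m := by
        have : 4 * (2 ^ c * E) = (3 * s + 1) * E := by rw [hs]; ring
        rw [this]
        linear_combination 3 * hn - (3 * s + 1) * hE
      omega
    refine ⟨n, k, 2 ^ c * E, n - 2 ^ c * E, by omega, by omega, by omega, hpar, hkk ▸ hgpo, ?_⟩
    rintro ⟨C', hC'⟩
    have h := hC'.griesmer_le hF
    rw [hkk, show 2 * (2 ^ c * E + 1) = 2 * (2 ^ c * E) + 2 by ring] at h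
    omega
  · rw [AddCode.isGriesmer_iff hpar, hkk]
    exact AddCode.griesmer_code_eq_iff hm₁ hm₃ hE hs hn
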